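/- **Theorem.** The category of inverse semigroups and semigroup homomorphisms is equivalent to the category of self-supported categories, where the latter is defined as follows. (Composition is written from left to right.) A *category with subobjects* is a small category $\mathcal C$ with a subcategory $\mathcal P$ having the same objects, whose morphisms are called *inclusions*, such that: between any two objects there is at most one inclusion, and the only isomorphisms of $\mathcal P$ are identities; every inclusion is a monomorphism of $\mathcal C$; and if $f=hg$ with $f,g\in\mathcal P$ and $h\in\mathcal C$, then $h\in\mathcal P$. Write $c\preceq c'$ if there is an inclusion $j(c,c')\colon c\to c'$; this is a partial order on the set $v\mathcal C$ of objects. A *retraction* is a morphism $q\colon c'\to c$ with $j(c,c')q=1_c$ for some inclusion $j(c,c')$. A *cone* with vertex $z$ is a family of morphisms $\gamma(c)\colon c\to z$ ($c\in v\mathcal C$) with $j(a,b)\gamma(b)=\gamma(a)$ whenever $a\preceq b$, at least one of which is an isomorphism. The category $\mathcal C$ is *normal* if every inclusion splits (has a right inverse in $\mathcal C$), every morphism is of the form $quj$ with $q$ a retraction, $u$ an isomorphism and $j$ an inclusion, and for each object $c$ there is a cone $\mu$ with vertex $c$ and $\mu(c)=1_c$. Let $\mathcal C$ be normal. Every morphism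 $f$ factors uniquely as $f=f^\circ j$ with $f^\circ$ an epimorphism and $j$ an inclusion, and the set $\widehat{\mathcal C}$ of all cones in $\mathcal C$ is a regular semigroup under $(\gamma\cdot\delta)(c)=\gamma(c)\,(\delta(z_\gamma))^\circ$, where $z_\gamma$ is the vertex of $\gamma$. Put $\gamma\leqslant_r\delta$ if $\gamma\in\delta\,\widehat{\mathcal C}$; this quasi-order induces the equivalence $\mathscr R$ and the poset $(\widehat{\mathcal C}/\mathscr R,\sqsubseteq)$. An object $c$ is *connected by* $\mathfrak d\in\widehat{\mathcal C}/\mathscr R$ if $\mathfrak d$ contains an idempotent cone with vertex $c$; this cone is then unique and is denoted by $\epsilon(c,\mathfrak d)$. A *connected category* $\mathcal C_{\mathfrak D}$ is a normal category $\mathcal C$ together with a down-set $\mathfrak D$ of $\widehat{\mathcal C}/\mathscr R$ such that every object of $\mathcal C$ is connected by some $\mathfrak d\in\mathfrak D$. It is *supported* if every object $c$ is connected by a unique $\mathfrak d\in\mathfrak D$, which is then denoted by $\Gamma(c)$; the map $\Gamma\colon v\mathcal C\to\mathfrak D$ is the *support map*. A supported category is *self-supported* if $\Gamma$ is an order isomorphism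 from $(v\mathcal C,\preceq)$ onto $(\mathfrak D,\sqsubseteq)$. A morphism $\mathcal C_{\mathfrak D}\to\mathcal C'_{\mathfrak D'}$ of connected categories is a pair $(F,G)$, where $F\colon\mathcal C\to\mathcal C'$ is a functor that maps inclusions to inclusions and $G\colon\mathfrak D\to\mathfrak D'$ is an order preserving map, such that whenever $c\in v\mathcal C$ is connected by $\mathfrak d\in\mathfrak D$, the object $F(c)$ is connected by $G(\mathfrak d)$ and $F(\epsilon(c,\mathfrak d)(c'))=\epsilon(F(c),G(\mathfrak d))(F(c'))$ for all $c'\in v\mathcal C$. Self-supported categories form a full subcategory of the category of connected categories so obtained. -/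

import Mathlib

open CategoryTheory

universe v u

namespace ConeSemigroups

/-! ### Categories with subobjects and normal categories

Composition `f ≫ g` is written in the order "first `f`, then `g`". -/

/-- A category with subobjects: a wide subcategory `incl` of `C` (its morphisms are called
inclusions) which is a strict preorder, consists of monomorphisms of `C`, and is such that
`h ≫ g ∈ incl` and `g ∈ incl` imply `h ∈ incl`. -/
class CategoryWithSubobjects (C : Type u) [Category.{v} C] where
  /-- the inclusions -/
  incl : MorphismProperty C
  id_incl : ∀ X : C, incl (𝟙 X)
  comp_incl : ∀ {X Y Z : C} (f : X ⟶ Y) (g : Y ⟶ Z), incl f → incl g → incl (f ≫ g)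
  /-- there is at most one inclusion between two given objects -/
  incl_unique : ∀ {X Y : C} (f g : X ⟶ Y), incl f → incl g → f = g
  /-- the only isomorphisms of the subcategory of inclusions are the identities -/
  incl_strict : ∀ {X Y : C} (f : X ⟶ Y) (g : Y ⟶ X), incl f → incl g →
    f ≫ g = 𝟙 X → g ≫ f = 𝟙 Y → ∃ h : X = Y, f = eqToHom h
  mono_of_incl : ∀ {X Y : C} (f : X ⟶ Y), incl f → Mono f
  incl_of_comp : ∀ {X Y Z : C} (h : X ⟶ Y) (g : Y ⟶ Z), incl (h ≫ g) → incl g → incl h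

section Subobjects

variable {C : Type u} [Category.{v} C] [CategoryWithSubobjects C]

/-- `f` is an inclusion. -/
abbrev IsInclusion {X Y : C} (f : X ⟶ Y) : Prop := CategoryWithSubobjects.incl f

/-- The partial order `a ⪯ b` on the objects: there is an inclusion `a ⟶ b`. -/
def SubLE (a b : C) : Prop := ∃ j : a ⟶ b, IsInclusion j

/-- A retraction is a right inverse of some inclusion. -/
def IsRetr {X Y : C} (q : X ⟶ Y) : Prop := ∃ j : Y ⟶ X, IsInclusion j ∧ j ≫ q = 𝟙 Y

/-- `f = q u j` with `q` a retraction, `u` an isomorphism and `j` an inclusion. -/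
def HasNormalFactorisation {X Y : C} (f : X ⟶ Y) : Prop :=
  ∃ (A B : C) (q : X ⟶ A) (w : A ⟶ B) (j : B ⟶ Y),
    IsRetr q ∧ IsIso w ∧ IsInclusion j ∧ f = q ≫ w ≫ j

/-- Cones with vertex `z`: families `γ(c) : c ⟶ z`, compatible with the inclusions, such that at
least one component is an isomorphism. -/
@[ext]
structure ConeAt (z : C) where
  app : ∀ c : C, c ⟶ z
  incl_app : ∀ {a b : C} (j : a ⟶ b), IsInclusion j → j ≫ app b = app a
  exists_isIso : ∃ c : C, IsIso (app c)

end Subobjects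

/-- Normal categories. -/
class NormalCategory (C : Type u) [Category.{v} C] extends CategoryWithSubobjects C where
  /-- every inclusion splits -/
  split : ∀ {X Y : C} (j : X ⟶ Y), IsInclusion j → ∃ q : Y ⟶ X, j ≫ q = 𝟙 X
  normal_factorisation : ∀ {X Y : C} (f : X ⟶ Y), HasNormalFactorisation f
  exists_cone : ∀ c : C, ∃ μ : ConeAt c, μ.app c = 𝟙 c

section SubobjectFacts

variable {C : Type u} [Category.{v} C] [CategoryWithSubobjects C]

theorem eq_of_incl_incl {X Y : C} (f : X ⟶ Y) (g : Y ⟶ X) (hf : IsInclusion f)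
    (hg : IsInclusion g) : ∃ h : X = Y, f = eqToHom h :=
  CategoryWithSubobjects.incl_strict f g hf hg
    (CategoryWithSubobjects.incl_unique _ _ (CategoryWithSubobjects.comp_incl _ _ hf hg)
      (CategoryWithSubobjects.id_incl _))
    (CategoryWithSubobjects.incl_unique _ _ (CategoryWithSubobjects.comp_incl _ _ hg hf)
      (CategoryWithSubobjects.id_incl _))

theorem incl_eqToHom {X Y : C} (h : X = Y) : IsInclusion (eqToHom h) := by
  subst h
  exact CategoryWithSubobjects.id_incl _

/-- A retraction followed by an isomorphism has a one-sided inverse. -/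
theorem IsRetr.exists_section {X A B : C} {q : X ⟶ A} (hq : IsRetr q) (w : A ⟶ B) [IsIso w] :
    ∃ s : B ⟶ X, s ≫ q ≫ w = 𝟙 B := by
  obtain ⟨j, _, hj⟩ := hq
  refine ⟨inv w ≫ j, ?_⟩
  rw [Category.assoc, ← Category.assoc j, hj]
  simp

theorem eq_of_section {X Z Z' Y : C} (p : X ⟶ Z) (j : Z ⟶ Y) (p' : X ⟶ Z') (j' : Z' ⟶ Y)
    (hp : ∃ s : Z ⟶ X, s ≫ p = 𝟙 Z) (hp' : ∃ s : Z' ⟶ X, s ≫ p' = 𝟙 Z')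
    (hj : IsInclusion j) (hj' : IsInclusion j') (h : p ≫ j = p' ≫ j') :
    ∃ e : Z = Z', p ≫ eqToHom e = p' := by
  obtain ⟨s, hs⟩ := hp
  obtain ⟨s', hs'⟩ := hp'
  have h1 : (s ≫ p') ≫ j' = j := by
    rw [Category.assoc, ← h, ← Category.assoc, hs, Category.id_comp]
  have h2 : (s' ≫ p) ≫ j = j' := by
    rw [Category.assoc, h, ← Category.assoc, hs', Category.id_comp]
  have i1 : IsInclusion (s ≫ p') :=
    CategoryWithSubobjects.incl_of_comp _ j' (by rw [h1]; exact hj) hj'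
  have i2 : IsInclusion (s' ≫ p) :=
    CategoryWithSubobjects.incl_of_comp _ j (by rw [h2]; exact hj') hj
  obtain ⟨e, he⟩ := eq_of_incl_incl _ _ i1 i2
  refine ⟨e, ?_⟩
  have := CategoryWithSubobjects.mono_of_incl j' hj'
  rw [← cancel_mono j', Category.assoc, ← he, h1, h]

end SubobjectFacts

section Normal

variable {C : Type u} [Category.{v} C] [NormalCategory C]

/-- In a normal category every epimorphism is a retraction followed by an isomorphism. -/
theorem exists_section_of_epi {X Y : C} (p : X ⟶ Y) [Epi p] :
    ∃ (A : C) (q : X ⟶ A) (w : A ⟶ Y), IsRetr q ∧ IsIso w ∧ p = q ≫ w := by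
  obtain ⟨A, B, q, w, j, hq, hw, hj, hf⟩ := NormalCategory.normal_factorisation p
  obtain ⟨r, hr⟩ := NormalCategory.split j hj
  have : Epi j := by
    have : Epi ((q ≫ w) ≫ j) := by rw [Category.assoc, ← hf]; infer_instance
    exact epi_of_epi (q ≫ w) j
  have hr' : r ≫ j = 𝟙 Y := by
    rw [← cancel_epi j, ← Category.assoc, hr, Category.id_comp, Category.comp_id]
  have ir : IsInclusion r := CategoryWithSubobjects.incl_of_comp r j
    (by rw [hr']; exact CategoryWithSubobjects.id_incl _) hj
  obtain ⟨e, he⟩ := eq_of_incl_incl j r hj ir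
  subst e
  refine ⟨A, q, w, hq, hw, ?_⟩
  rw [hf, he]
  simp

/-- Uniqueness of the canonical factorisation `f = p j` with `p` an epimorphism and `j` an
inclusion. -/
theorem canonical_unique {X Z Z' Y : C} (p : X ⟶ Z) (j : Z ⟶ Y) (p' : X ⟶ Z') (j' : Z' ⟶ Y)
    [Epi p] [Epi p'] (hj : IsInclusion j) (hj' : IsInclusion j') (h : p ≫ j = p' ≫ j') :
    ∃ e : Z = Z', p ≫ eqToHom e = p' := by
  refine eq_of_section p j p' j' ?_ ?_ hj hj' h
  · obtain ⟨A, q, w, hq, hw, rfl⟩ := exists_section_of_epi p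
    exact hq.exists_section w
  · obtain ⟨A, q, w, hq, hw, rfl⟩ := exists_section_of_epi p'
    exact hq.exists_section w

theorem exists_canonical {X Y : C} (f : X ⟶ Y) :
    ∃ (Z : C) (p : X ⟶ Z) (j : Z ⟶ Y), Epi p ∧ IsInclusion j ∧ p ≫ j = f := by
  obtain ⟨A, B, q, w, j, hq, hw, hj, hf⟩ := NormalCategory.normal_factorisation f
  refine ⟨B, q ≫ w, j, ?_, hj, by rw [hf, Category.assoc]⟩
  obtain ⟨s, hs⟩ := hq.exists_section w
  exact (IsSplitEpi.mk' ⟨s, hs⟩).epi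

/-- The image of `f`: the middle object of the canonical factorisation of `f`. -/
noncomputable def im {X Y : C} (f : X ⟶ Y) : C := (exists_canonical f).choose

/-- The epimorphic component `f°` of `f`. -/
noncomputable def epiPart {X Y : C} (f : X ⟶ Y) : X ⟶ im f :=
  (exists_canonical f).choose_spec.choose

/-- The inclusion of `f`. -/
noncomputable def inclPart {X Y : C} (f : X ⟶ Y) : im f ⟶ Y :=
  (exists_canonical f).choose_spec.choose_spec.choose

instance epi_epiPart {X Y : C} (f : X ⟶ Y) : Epi (epiPart f) :=
  (exists_canonical f).choose_spec.choose_spec.choose_spec.1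

theorem inclPart_incl {X Y : C} (f : X ⟶ Y) : IsInclusion (inclPart f) :=
  (exists_canonical f).choose_spec.choose_spec.choose_spec.2.1

theorem epiPart_inclPart {X Y : C} (f : X ⟶ Y) : epiPart f ≫ inclPart f = f :=
  (exists_canonical f).choose_spec.choose_spec.choose_spec.2.2

/-- The cone `γ ∗ p : c ↦ γ(c) p`, for an epimorphism `p` starting at the vertex of `γ`. -/
def ConeAt.star {z y : C} (γ : ConeAt z) (p : z ⟶ y) [Epi p] : ConeAt y where
  app c := γ.app c ≫ p
  incl_app j hj := by rw [← Category.assoc, γ.incl_app j hj]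
  exists_isIso := by
    obtain ⟨d, hd⟩ := γ.exists_isIso
    obtain ⟨A, q, w, ⟨j, hj, hjq⟩, hw, rfl⟩ := exists_section_of_epi p
    obtain ⟨c, m, i, hm, hi, hmi⟩ := exists_canonical (j ≫ inv (γ.app d))
    have : Mono j := CategoryWithSubobjects.mono_of_incl j hj
    have : Mono (m ≫ i) := by rw [hmi]; infer_instance
    have : Mono m := mono_of_mono m i
    have hms : ∃ s : c ⟶ A, s ≫ m = 𝟙 c := by
      obtain ⟨B, q', w', hq', hw', h'⟩ := exists_section_of_epi m
      subst h'
      exact hq'.exists_section w'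
    obtain ⟨s, hs⟩ := hms
    have hs' : m ≫ s = 𝟙 A := by
      rw [← cancel_mono m, Category.assoc, hs, Category.id_comp, Category.comp_id]
    have key : γ.app c ≫ q = s := by
      have h1 : m ≫ γ.app c = j := by
        rw [← γ.incl_app i hi, ← Category.assoc, hmi, Category.assoc, IsIso.inv_hom_id,
          Category.comp_id]
      have h2 : m ≫ (γ.app c ≫ q) = m ≫ s := by rw [← Category.assoc, h1, hjq, hs']
      exact (cancel_epi m).1 h2
    have : IsIso s := ⟨m, hs, hs'⟩
    refine ⟨c, ?_⟩
    rw [← Category.assoc, key]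
    infer_instance

/-! ### The semigroup of cones and the poset of its `R`-classes -/

variable (C) in
/-- The set `Ĉ` of all cones in `C`. -/
structure Cones where
  vertex : C
  cone : ConeAt vertex

theorem Cones.ext_eqToHom {γ δ : Cones C} (h : γ.vertex = δ.vertex)
    (H : ∀ c, γ.cone.app c ≫ eqToHom h = δ.cone.app c) : γ = δ := by
  obtain ⟨z, γ⟩ := γ
  obtain ⟨y, δ⟩ := δ
  dsimp at h
  subst h
  congr 1
  ext c
  simpa using H c

theorem Cones.exists_eqToHom {γ δ : Cones C} (H : γ = δ) :
    ∃ h : γ.vertex = δ.vertex, ∀ c, γ.cone.app c ≫ eqToHom h = δ.cone.app c := by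
  subst H
  exact ⟨rfl, fun c => by simp⟩

/-- The product `γ · δ = γ ∗ (δ(z_γ))°`. -/
noncomputable instance : Mul (Cones C) where
  mul γ δ := ⟨im (δ.cone.app γ.vertex), γ.cone.star (epiPart (δ.cone.app γ.vertex))⟩

theorem Cones.mul_vertex (γ δ : Cones C) : (γ * δ).vertex = im (δ.cone.app γ.vertex) := rfl

theorem Cones.mul_app (γ δ : Cones C) (c : C) :
    (γ * δ).cone.app c = γ.cone.app c ≫ epiPart (δ.cone.app γ.vertex) := rfl

noncomputable instance : Semigroup (Cones C) where
  mul_assoc γ δ κ := by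
    have h : ∃ e : im (κ.cone.app (im (δ.cone.app γ.vertex))) = im ((δ * κ).cone.app γ.vertex),
        (epiPart (δ.cone.app γ.vertex) ≫ epiPart (κ.cone.app (im (δ.cone.app γ.vertex)))) ≫
          eqToHom e = epiPart ((δ * κ).cone.app γ.vertex) := by
      refine canonical_unique _ (inclPart (κ.cone.app (im (δ.cone.app γ.vertex)))) _
        (inclPart ((δ * κ).cone.app γ.vertex) ≫ inclPart (κ.cone.app δ.vertex))
        (inclPart_incl _)
        (CategoryWithSubobjects.comp_incl _ _ (inclPart_incl _) (inclPart_incl _)) ?_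
      rw [Category.assoc, epiPart_inclPart, ← Category.assoc, epiPart_inclPart, Cones.mul_app,
        Category.assoc, epiPart_inclPart, ← κ.cone.incl_app _ (inclPart_incl _), ← Category.assoc,
        epiPart_inclPart]
    obtain ⟨e, he⟩ := h
    refine Cones.ext_eqToHom e fun c => ?_
    rw [Cones.mul_app γ (δ * κ), ← he]
    change ((γ.cone.app c ≫ epiPart (δ.cone.app γ.vertex)) ≫
      epiPart (κ.cone.app (im (δ.cone.app γ.vertex)))) ≫ eqToHom e = _
    simp only [Category.assoc]

theorem Cones.mul_eq_left {z : C} (γ δ : ConeAt z) (h : δ.app z = 𝟙 z) :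
    (⟨z, γ⟩ * ⟨z, δ⟩ : Cones C) = ⟨z, γ⟩ := by
  obtain ⟨e, he⟩ := canonical_unique (epiPart (δ.app z)) (inclPart (δ.app z)) (𝟙 z) (𝟙 z)
    (inclPart_incl _) (CategoryWithSubobjects.id_incl z)
    (by rw [epiPart_inclPart, h, Category.comp_id])
  refine Cones.ext_eqToHom e fun c => ?_
  change (γ.app c ≫ epiPart (δ.app z)) ≫ eqToHom e = γ.app c
  rw [Category.assoc, he, Category.comp_id]

/-- The quasi-order `γ ≤ᵣ δ ↔ γ ∈ δ Ĉ` on the semigroup of cones. -/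
instance : Preorder (Cones C) where
  le γ δ := ∃ χ : Cones C, γ = δ * χ
  le_refl γ := by
    obtain ⟨z, γ⟩ := γ
    obtain ⟨μ, hμ⟩ := NormalCategory.exists_cone z
    exact ⟨⟨z, μ⟩, (Cones.mul_eq_left γ μ hμ).symm⟩
  le_trans γ δ κ := by
    rintro ⟨χ, rfl⟩ ⟨ψ, rfl⟩
    exact ⟨ψ * χ, mul_assoc _ _ _⟩

variable (C) in
/-- The poset `Ĉ / R` of the `R`-classes of the semigroup of cones, where
`R = ≤ᵣ ∩ (≤ᵣ)⁻¹`, ordered by `R_γ ⊑ R_δ ↔ γ ≤ᵣ δ`. -/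
abbrev RClasses := Antisymmetrization (Cones C) (· ≤ ·)

/-- The `R`-class of the cone `γ` with vertex `c`. -/
def rClass {c : C} (γ : ConeAt c) : RClasses C :=
  toAntisymmetrization (· ≤ ·) (⟨c, γ⟩ : Cones C)

/-- The cone `ε` with vertex `c` is an idempotent of the semigroup of cones. -/
def ConeAt.IsIdem {c : C} (ε : ConeAt c) : Prop := IsIdempotentElem (⟨c, ε⟩ : Cones C)

/-- The object `c` is connected by `d`: the `R`-class `d` contains an idempotent cone with
vertex `c`. -/
def IsConnectedBy (c : C) (d : RClasses C) : Prop :=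
  ∃ ε : ConeAt c, ε.IsIdem ∧ rClass ε = d

theorem ConeAt.IsIdem.app_vertex {c : C} {ε : ConeAt c} (h : ε.IsIdem) : ε.app c = 𝟙 c := by
  obtain ⟨e, he⟩ := Cones.exists_eqToHom h
  obtain ⟨d, hd⟩ := ε.exists_isIso
  have h1 := he d
  change (ε.app d ≫ epiPart (ε.app c)) ≫ eqToHom e = ε.app d at h1
  rw [Category.assoc] at h1
  have h2 : epiPart (ε.app c) ≫ eqToHom e = 𝟙 c := by
    rw [← cancel_epi (ε.app d), h1, Category.comp_id]
  have h3 : inclPart (ε.app c) = eqToHom e :=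
    CategoryWithSubobjects.incl_unique _ _ (inclPart_incl _) (incl_eqToHom e)
  rw [← epiPart_inclPart (ε.app c), h3, h2]

/-- An idempotent cone is determined by its vertex and its `R`-class. -/
theorem idem_unique {c : C} {ε ε' : ConeAt c} (h : ε.IsIdem) (h' : ε'.IsIdem)
    (hr : rClass ε = rClass ε') : ε = ε' := by
  have hle : (⟨c, ε⟩ : Cones C) ≤ ⟨c, ε'⟩ := (Quotient.exact hr).1
  obtain ⟨χ, hχ⟩ := hle
  have h1 : (⟨c, ε'⟩ * ⟨c, ε⟩ : Cones C) = ⟨c, ε⟩ := by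
    rw [hχ, ← mul_assoc, h'.eq]
  have h2 := Cones.mul_eq_left ε' ε h.app_vertex
  have h3 : (⟨c, ε⟩ : Cones C) = ⟨c, ε'⟩ := h1.symm.trans h2
  simpa using h3

/-- The unique idempotent cone `ε(c, d)` with vertex `c` in the `R`-class `d`, for an object `c`
connected by `d`. -/
noncomputable def idemCone {c : C} {d : RClasses C} (h : IsConnectedBy c d) : ConeAt c :=
  h.choose

theorem idemCone_isIdem {c : C} {d : RClasses C} (h : IsConnectedBy c d) :
    (idemCone h).IsIdem := h.choose_spec.1

theorem rClass_idemCone {c : C} {d : RClasses C} (h : IsConnectedBy c d) :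
    rClass (idemCone h) = d := h.choose_spec.2

end Normal

/-! ### Connected, supported and self-supported categories -/

/-- A connected category: a small normal category together with a down-set `down` of the poset of
`R`-classes of its semigroup of cones such that every object is connected by some element of
the down-set. -/
structure ConnectedCat where
  carrier : Type u
  [cat : SmallCategory carrier]
  [normal : NormalCategory carrier]
  down : LowerSet (RClasses carrier)
  connected : ∀ c : carrier, ∃ d : down, IsConnectedBy c d.1

attribute [instance] ConnectedCat.cat ConnectedCat.normal

/-- Morphisms of connected categories: pairs of an inclusion preserving functor `F` and an order
preserving map `G` of the down-sets such that, whenever `c` is connected by `d`, the object `F c`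
is connected by `G d` and `F(ε(c, d)(c')) = ε(F c, G d)(F c')` for every object `c'`. -/
@[ext]
structure CCHom (X Y : ConnectedCat.{u}) where
  functor : X.carrier ⥤ Y.carrier
  map_incl : ∀ {a b : X.carrier} (j : a ⟶ b), IsInclusion j → IsInclusion (functor.map j)
  onDown : X.down →o Y.down
  map_connected : ∀ (c : X.carrier) (d : X.down), IsConnectedBy c d.1 →
    IsConnectedBy (functor.obj c) (onDown d).1
  map_idemCone : ∀ (c : X.carrier) (d : X.down) (h : IsConnectedBy c d.1) (c' : X.carrier),
    functor.map ((idemCone h).app c') =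
      (idemCone (map_connected c d h)).app (functor.obj c')

/-- The category of connected categories. -/
instance : Category ConnectedCat.{u} where
  Hom := CCHom
  id X :=
    { functor := 𝟭 X.carrier
      map_incl := fun _ hj => hj
      onDown := OrderHom.id
      map_connected := fun _ _ h => h
      map_idemCone := fun _ _ _ _ => rfl }
  comp m n :=
    { functor := m.functor ⋙ n.functor
      map_incl := fun j hj => n.map_incl _ (m.map_incl j hj)
      onDown := n.onDown.comp m.onDown
      map_connected := fun c d h => n.map_connected _ _ (m.map_connected c d h)
      map_idemCone := fun c d h c' => by
        rw [Functor.comp_map, m.map_idemCone c d h c',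
          n.map_idemCone _ _ (m.map_connected c d h)]
        rfl }

/-- A connected category is supported if each object is connected by a unique element of the
down-set. -/
def IsSupported (X : ConnectedCat.{u}) : Prop :=
  ∀ c : X.carrier, ∃! d : X.down, IsConnectedBy c d.1

/-- The support map of a supported category: it sends an object `c` to the element of the down-set
by which `c` is connected. -/
noncomputable def supportMap {X : ConnectedCat.{u}} (hX : IsSupported X) (c : X.carrier) : X.down :=
  (hX c).choose

/-- A self-supported category: a supported category whose support map is an order isomorphism
from the poset of objects onto the down-set. -/
def IsSelfSupported : ObjectProperty ConnectedCat.{u} := fun X =>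
  ∃ hX : IsSupported X, Function.Bijective (supportMap hX) ∧
    ∀ a b : X.carrier, SubLE a b ↔ supportMap hX a ≤ supportMap hX b

/-- The category of self-supported categories, a full subcategory of the category of connected
categories. -/
abbrev SelfSupportedCat := IsSelfSupported.{u}.FullSubcategory

/-! ### Inverse semigroups -/

/-- Inverse semigroups: every element `a` has an inverse `x`, and the idempotents commute. -/
def IsInverseSemigroup : ObjectProperty Semigrp.{u} := fun S =>
  (∀ a : S, ∃ x : S, a * x * a = a ∧ x * a * x = x) ∧
    ∀ e f : S, IsIdempotentElem e → IsIdempotentElem f → e * f = f * e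

/-- The category of inverse semigroups, with semigroup homomorphisms as morphisms. -/
abbrev InverseSemigrp := IsInverseSemigroup.{u}.FullSubcategory

end ConeSemigroups


/-!
The idempotents `e` of an inverse semigroup `S` index the principal left ideals `S e`, and these
form a category whose morphisms `S e ⟶ S f` are the right translations by the elements of `e S f`.
The element `a` of `S` yields the principal cone `S f ⟶ S f a`, the principal cones form a copy of
`S` in the semigroup of all cones, and their `R`-classes form a down-set for which the category is
self-supported. The idempotent cone with vertex `S e` consists of the translations by the products
`f e`. A morphism of connected categories preserves these translations, and as
`a b = a (a⁻¹ a) (b b⁻¹) b` is a composite of `a`, a translation by a product of idempotents and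
`b`, it comes from exactly one homomorphism of semigroups.

Conversely, the cones whose `R`-classes lie in the down-set of a self-supported category form a
semigroup with exactly one idempotent cone for each object, and the two halves of the order
isomorphism turn this into one idempotent in each `L`-class and one in each `R`-class. Hence the
semigroup is inverse, and sending an idempotent cone to its vertex is an isomorphism from its
category of principal left ideals onto the given category.
-/

namespace ConeSemigroups

/-! ### Inclusions and cones -/

section Subobjects

variable {C : Type u} [Category.{v} C] [CategoryWithSubobjects C]

theorem SubLE.antisymm {a b : C} (h : SubLE a b) (h' : SubLE b a) : a = b := by
  obtain ⟨j, hj⟩ := h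
  obtain ⟨k, hk⟩ := h'
  exact (eq_of_incl_incl j k hj hk).choose

/-- The inclusion `j(a, b)` of an object `a` into an object `b` with `a ⪯ b`. -/
noncomputable def SubLE.incl {a b : C} (h : SubLE a b) : a ⟶ b := h.choose

theorem SubLE.isInclusion_incl {a b : C} (h : SubLE a b) : IsInclusion h.incl := h.choose_spec

theorem SubLE.eq_incl {a b : C} (h : SubLE a b) {j : a ⟶ b} (hj : IsInclusion j) : j = h.incl :=
  CategoryWithSubobjects.incl_unique _ _ hj h.isInclusion_incl

theorem isInclusion_eqToHom_comp_comp_eqToHom {a a' b b' : C} (ha : a' = a) (hb : b = b')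
    {j : a ⟶ b} (hj : IsInclusion j) : IsInclusion (eqToHom ha ≫ j ≫ eqToHom hb) :=
  CategoryWithSubobjects.comp_incl _ _ (incl_eqToHom ha)
    (CategoryWithSubobjects.comp_incl _ _ hj (incl_eqToHom hb))

theorem ConeAt.app_eq_eqToHom_comp (ε : ∀ c : C, ConeAt c) {c c' d d' : C} (hc : c = c')
    (hd : d = d') : (ε c).app d = eqToHom hd ≫ (ε c').app d' ≫ eqToHom hc.symm := by
  subst hc hd
  simp

end Subobjects

section Cones

variable {C : Type u} [Category.{v} C] [NormalCategory C]

theorem ConeAt.star_id {z : C} (γ : ConeAt z) : γ.star (𝟙 z) = γ :=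
  ConeAt.ext (funext fun _ => Category.comp_id _)

namespace Cones

theorem mul_eq_star (γ δ : Cones C) {y : C} (p : γ.vertex ⟶ y) [Epi p] (j : y ⟶ δ.vertex)
    (hj : IsInclusion j) (h : p ≫ j = δ.cone.app γ.vertex) : γ * δ = ⟨y, γ.cone.star p⟩ := by
  obtain ⟨hy, hp⟩ := canonical_unique (epiPart (δ.cone.app γ.vertex))
    (inclPart (δ.cone.app γ.vertex)) p j (inclPart_incl _) hj (by rw [epiPart_inclPart, h])
  refine ext_eqToHom hy fun c => ?_
  rw [mul_app, Category.assoc, hp, ConeAt.star]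

theorem mul_star {γ : Cones C} (hγ : γ.cone.app γ.vertex = 𝟙 _) {y : C} (p : γ.vertex ⟶ y)
    [Epi p] : γ * ⟨y, γ.cone.star p⟩ = ⟨y, γ.cone.star p⟩ :=
  mul_eq_star γ _ p (𝟙 y) (CategoryWithSubobjects.id_incl y) (by
    change p ≫ 𝟙 y = γ.cone.app γ.vertex ≫ p
    rw [hγ, Category.id_comp, Category.comp_id])

theorem mul_eq_left_of_subLE {γ δ : Cones C} (hδ : δ.cone.app δ.vertex = 𝟙 _)
    (h : SubLE γ.vertex δ.vertex) : γ * δ = γ := by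
  obtain ⟨j, hj⟩ := h
  rw [mul_eq_star γ δ (𝟙 _) j hj, ConeAt.star_id]
  rw [← δ.cone.incl_app j hj, hδ, Category.comp_id, Category.id_comp]

theorem subLE_vertex_mul (γ δ : Cones C) : SubLE (γ * δ).vertex δ.vertex :=
  ⟨inclPart (δ.cone.app γ.vertex), inclPart_incl _⟩

theorem epi_app_vertex_of_mul_eq {γ δ : Cones C} (hγ : γ.cone.app γ.vertex = 𝟙 _)
    (h : γ * δ = δ) : Epi (δ.cone.app γ.vertex) := by
  obtain ⟨hv, happ⟩ := exists_eqToHom h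
  rw [← happ, mul_app, hγ, Category.id_comp]
  infer_instance

theorem app_eq_app_comp_app_vertex_of_mul_eq {γ δ : Cones C}
    (hγ : γ.cone.app γ.vertex = 𝟙 _) (h : γ * δ = δ) (c : C) :
    δ.cone.app c = γ.cone.app c ≫ δ.cone.app γ.vertex := by
  obtain ⟨hv, happ⟩ := exists_eqToHom h
  rw [← happ, ← happ, mul_app, mul_app, hγ, Category.id_comp, Category.assoc]

theorem mul_le_left (γ δ : Cones C) : γ * δ ≤ γ := ⟨δ, rfl⟩

theorem mul_eq_right_of_le {γ δ : Cones C} (hδ : IsIdempotentElem δ) (h : γ ≤ δ) :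
    δ * γ = γ := by
  obtain ⟨χ, rfl⟩ := h
  exact hδ.mul_self_mul χ

end Cones

theorem rClass_le_rClass {c d : C} {γ : ConeAt c} {δ : ConeAt d} :
    rClass γ ≤ rClass δ ↔ (⟨c, γ⟩ : Cones C) ≤ ⟨d, δ⟩ := Iff.rfl

end Cones

/-! ### Supported and self-supported categories -/

section Supported

variable {X Y : ConnectedCat.{u}}

namespace IsSupported

theorem isConnectedBy_supportMap (hX : IsSupported X) (c : X.carrier) :
    IsConnectedBy c (supportMap hX c).1 := (hX c).choose_spec.1

theorem eq_supportMap (hX : IsSupported X) {c : X.carrier} {d : X.down}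
    (h : IsConnectedBy c d.1) : d = supportMap hX c := (hX c).choose_spec.2 d h

/-- The idempotent cone `ε(c, Γ(c))` with vertex `c` in the support of `c`. -/
noncomputable def suppCone (hX : IsSupported X) (c : X.carrier) : ConeAt c :=
  idemCone (hX.isConnectedBy_supportMap c)

theorem isIdem_suppCone (hX : IsSupported X) (c : X.carrier) : (hX.suppCone c).IsIdem :=
  idemCone_isIdem _

theorem rClass_suppCone (hX : IsSupported X) (c : X.carrier) :
    rClass (hX.suppCone c) = (supportMap hX c).1 := rClass_idemCone _

theorem rClass_suppCone_mem (hX : IsSupported X) (c : X.carrier) :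
    rClass (hX.suppCone c) ∈ X.down :=
  hX.rClass_suppCone c ▸ (supportMap hX c).2

theorem eq_suppCone (hX : IsSupported X) {c : X.carrier} {ε : ConeAt c} (hε : ε.IsIdem)
    (hd : rClass ε ∈ X.down) : ε = hX.suppCone c := by
  refine idem_unique hε (hX.isIdem_suppCone c) ?_
  rw [hX.rClass_suppCone, ← hX.eq_supportMap (d := ⟨rClass ε, hd⟩) ⟨ε, hε, rfl⟩]

theorem idemCone_eq_suppCone (hX : IsSupported X) {c : X.carrier} {d : X.down}
    (h : IsConnectedBy c d.1) : idemCone h = hX.suppCone c :=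
  hX.eq_suppCone (idemCone_isIdem h) ((rClass_idemCone h).symm ▸ d.2)

end IsSupported

namespace IsSelfSupported

theorem supported (hX : IsSelfSupported X) : IsSupported X := hX.choose

theorem bijective_supportMap (hX : IsSelfSupported X) :
    Function.Bijective (supportMap hX.supported) := hX.choose_spec.1

theorem subLE_iff (hX : IsSelfSupported X) {a b : X.carrier} :
    SubLE a b ↔ supportMap hX.supported a ≤ supportMap hX.supported b := hX.choose_spec.2 a b

/-- The object of a self-supported category with a given support, that is, `Γ⁻¹`. -/
noncomputable def objOfSupport (hX : IsSelfSupported X) (d : X.down) : X.carrier :=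
  (Equiv.ofBijective _ hX.bijective_supportMap).symm d

theorem supportMap_objOfSupport (hX : IsSelfSupported X) (d : X.down) :
    supportMap hX.supported (hX.objOfSupport d) = d :=
  Equiv.ofBijective_apply_symm_apply _ hX.bijective_supportMap d

theorem isConnectedBy_objOfSupport (hX : IsSelfSupported X) (d : X.down) :
    IsConnectedBy (hX.objOfSupport d) d.1 := by
  simpa only [hX.supportMap_objOfSupport] using
    hX.supported.isConnectedBy_supportMap (hX.objOfSupport d)

theorem objOfSupport_eq (hX : IsSelfSupported X) {c : X.carrier} {d : X.down}
    (h : IsConnectedBy c d.1) : hX.objOfSupport d = c :=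
  hX.bijective_supportMap.1 ((hX.supportMap_objOfSupport d).trans (hX.supported.eq_supportMap h))

end IsSelfSupported

namespace CCHom

/-- The morphism of connected categories given by an inclusion preserving functor that preserves the
idempotent cones of the supports; its map of the down-sets is `Γ ∘ F ∘ Γ⁻¹`. -/
noncomputable def ofFunctor (hX : IsSelfSupported X) (hY : IsSelfSupported Y)
    (F : X.carrier ⥤ Y.carrier)
    (hF : ∀ {a b : X.carrier} (j : a ⟶ b), IsInclusion j → IsInclusion (F.map j))
    (hε : ∀ c c' : X.carrier, F.map ((hX.supported.suppCone c).app c') =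
      (hY.supported.suppCone (F.obj c)).app (F.obj c')) : CCHom X Y where
  functor := F
  map_incl := hF
  onDown :=
    { toFun := fun d => supportMap hY.supported (F.obj (hX.objOfSupport d))
      monotone' := fun d d' h => by
        obtain ⟨j, hj⟩ : SubLE (hX.objOfSupport d) (hX.objOfSupport d') :=
          hX.subLE_iff.2 (by simpa only [hX.supportMap_objOfSupport] using h)
        exact hY.subLE_iff.1 ⟨F.map j, hF j hj⟩ }
  map_connected c d h := by
    obtain rfl := hX.objOfSupport_eq h
    exact hY.supported.isConnectedBy_supportMap _
  map_idemCone c d h c' := by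
    rw [hX.supported.idemCone_eq_suppCone, hε, hY.supported.idemCone_eq_suppCone]

theorem map_suppCone (m : CCHom X Y) (hX : IsSupported X) (hY : IsSupported Y)
    (c c' : X.carrier) : m.functor.map ((hX.suppCone c).app c') =
      (hY.suppCone (m.functor.obj c)).app (m.functor.obj c') := by
  rw [IsSupported.suppCone, m.map_idemCone, hY.idemCone_eq_suppCone]

theorem ext_functor (hX : IsSelfSupported X) (hY : IsSupported Y) {m n : CCHom X Y}
    (h : m.functor = n.functor) : m = n := by
  refine CCHom.ext h (OrderHom.ext _ _ (funext fun d => ?_))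
  have hm := m.map_connected _ _ (hX.isConnectedBy_objOfSupport d)
  have hn := n.map_connected _ _ (hX.isConnectedBy_objOfSupport d)
  rw [← h] at hn
  exact (hY.eq_supportMap hm).trans (hY.eq_supportMap hn).symm

end CCHom

end Supported

/-! ### Strict inverses of functors -/

section StrictInverse

variable {A : Type*} {B : Type*} [Category* A] [Category* B] (F : A ⥤ B) [F.Full] [F.Faithful]
  (hF : Function.Bijective F.obj)

/-- The strict inverse of a fully faithful functor that is bijective on objects. -/
noncomputable def strictInverse : B ⥤ A where
  obj b := (Equiv.ofBijective F.obj hF).symm b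
  map f := F.preimage (eqToHom (Equiv.ofBijective_apply_symm_apply _ hF _) ≫ f ≫
    eqToHom (Equiv.ofBijective_apply_symm_apply _ hF _).symm)
  map_id b := F.map_injective (by simp)
  map_comp f g := F.map_injective (by simp)

theorem obj_strictInverse_obj (b : B) : F.obj ((strictInverse F hF).obj b) = b :=
  Equiv.ofBijective_apply_symm_apply _ hF b

theorem strictInverse_obj_obj (a : A) : (strictInverse F hF).obj (F.obj a) = a :=
  Equiv.ofBijective_symm_apply_apply _ hF a

theorem map_strictInverse_map {b b' : B} (f : b ⟶ b') :
    F.map ((strictInverse F hF).map f) = eqToHom (obj_strictInverse_obj F hF b) ≫ f ≫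
      eqToHom (obj_strictInverse_obj F hF b').symm :=
  F.map_preimage _

theorem strictInverse_comp : strictInverse F hF ⋙ F = 𝟭 B :=
  CategoryTheory.Functor.ext (obj_strictInverse_obj F hF) fun _ _ f => map_strictInverse_map F hF f

theorem comp_strictInverse : F ⋙ strictInverse F hF = 𝟭 A :=
  CategoryTheory.Functor.ext (strictInverse_obj_obj F hF) fun a a' f =>
    F.map_injective (by simp [map_strictInverse_map, eqToHom_map])

end StrictInverse

/-- The isomorphism of connected categories given by a fully faithful functor that is bijective on
objects, preserves and reflects inclusions, and preserves the idempotent cones of the supports. -/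
noncomputable def isoOfFunctor {X Y : ConnectedCat.{u}} (hX : IsSelfSupported X)
    (hY : IsSelfSupported Y) (F : X.carrier ⥤ Y.carrier) [F.Full] [F.Faithful]
    (hF : Function.Bijective F.obj)
    (hincl : ∀ {a b : X.carrier} (j : a ⟶ b), IsInclusion (F.map j) ↔ IsInclusion j)
    (hε : ∀ c c' : X.carrier, F.map ((hX.supported.suppCone c).app c') =
      (hY.supported.suppCone (F.obj c)).app (F.obj c')) : X ≅ Y where
  hom := CCHom.ofFunctor hX hY F (fun j => (hincl j).2) hε
  inv := CCHom.ofFunctor hY hX (strictInverse F hF)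
    (fun j hj => by
      rw [← hincl, map_strictInverse_map]
      exact isInclusion_eqToHom_comp_comp_eqToHom _ _ hj)
    (fun c c' => F.map_injective (by
      rw [hε, map_strictInverse_map]
      exact (ConeAt.app_eq_eqToHom_comp _ (obj_strictInverse_obj F hF c) _).symm))
  hom_inv_id := CCHom.ext_functor hX hX.supported (comp_strictInverse F hF)
  inv_hom_id := CCHom.ext_functor hY hY.supported (strictInverse_comp F hF)

/-! ### Inverse semigroups -/

/-- The elements `a` and `x` of a semigroup are inverses of each other. -/
structure MutuallyInverse {S : Type*} [Semigroup S] (a x : S) : Prop where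
  mul_mul_cancel_left : a * x * a = a
  mul_mul_cancel_right : x * a * x = x

namespace MutuallyInverse

variable {S : Type*} [Semigroup S] {a x e f : S}

theorem symm (h : MutuallyInverse a x) : MutuallyInverse x a := ⟨h.2, h.1⟩

theorem isIdempotentElem_mul (h : MutuallyInverse a x) : IsIdempotentElem (a * x) := by
  rw [IsIdempotentElem, ← mul_assoc, h.mul_mul_cancel_left]

theorem of_isIdempotentElem (he : IsIdempotentElem e) : MutuallyInverse e e :=
  ⟨by rw [he.eq, he.eq], by rw [he.eq, he.eq]⟩

theorem of_mul_mul_cancel (h : a * x * a = a) : MutuallyInverse a (x * a * x) where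
  mul_mul_cancel_left := by rw [← mul_assoc, ← mul_assoc, h, h]
  mul_mul_cancel_right := by
    calc x * a * x * a * (x * a * x) = x * (a * x * a * x * a) * x := by simp only [mul_assoc]
      _ = x * a * x := by rw [h, h]

theorem isIdempotentElem_mul_mul (h : MutuallyInverse (e * f) x) :
    IsIdempotentElem (f * x * e) := by
  calc f * x * e * (f * x * e) = f * (x * (e * f) * x) * e := by simp only [mul_assoc]
    _ = f * x * e := by rw [h.mul_mul_cancel_right]

theorem mul_mul_of_isIdempotentElem (he : IsIdempotentElem e) (hf : IsIdempotentElem f)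
    (h : MutuallyInverse (e * f) x) : MutuallyInverse (e * f) (f * x * e) where
  mul_mul_cancel_left := by
    calc e * f * (f * x * e) * (e * f) = e * f * x * (e * f) := by
          simp only [mul_assoc, he.mul_self_mul, hf.mul_self_mul]
      _ = e * f := h.mul_mul_cancel_left
  mul_mul_cancel_right := by
    calc f * x * e * (e * f) * (f * x * e) = f * (x * (e * f) * x) * e := by
          simp only [mul_assoc, he.mul_self_mul, hf.mul_self_mul]
      _ = f * x * e := by rw [h.mul_mul_cancel_right]

theorem mul_comm_of_isIdempotentElem (he : IsIdempotentElem e) (hf : IsIdempotentElem f)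
    (hef : IsIdempotentElem (e * f)) (hfe : IsIdempotentElem (f * e)) :
    MutuallyInverse (e * f) (f * e) where
  mul_mul_cancel_left := by
    simpa only [IsIdempotentElem, mul_assoc, he.mul_self_mul, hf.mul_self_mul] using hef
  mul_mul_cancel_right := by
    simpa only [IsIdempotentElem, mul_assoc, he.mul_self_mul, hf.mul_self_mul] using hfe

end MutuallyInverse

/-- The laws of inverse semigroups, for an unbundled semigroup. -/
class InverseSemigroup (S : Type*) [Semigroup S] : Prop where
  exists_mutuallyInverse : ∀ a : S, ∃ x : S, MutuallyInverse a x
  mul_comm_of_isIdempotentElem : ∀ {e f : S}, IsIdempotentElem e → IsIdempotentElem f →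
    e * f = f * e

namespace InverseSemigroup

section Criterion

variable {S : Type*} [Semigroup S]

theorem isIdempotentElem_mul_of_inverse_unique
    (hinv : ∀ a : S, ∃ x : S, MutuallyInverse a x)
    (huniq : ∀ {a x y : S}, MutuallyInverse a x → MutuallyInverse a y → x = y) {e f : S}
    (he : IsIdempotentElem e) (hf : IsIdempotentElem f) : IsIdempotentElem (e * f) := by
  obtain ⟨x, hx⟩ := hinv (e * f)
  have hidem : IsIdempotentElem (f * x * e) := hx.isIdempotentElem_mul_mul
  have heq : f * x * e = e * f :=
    huniq (.of_isIdempotentElem hidem) (hx.mul_mul_of_isIdempotentElem he hf).symm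
  exact heq ▸ hidem

theorem of_inverse_unique (hinv : ∀ a : S, ∃ x : S, MutuallyInverse a x)
    (huniq : ∀ {a x y : S}, MutuallyInverse a x → MutuallyInverse a y → x = y) :
    InverseSemigroup S where
  exists_mutuallyInverse := hinv
  mul_comm_of_isIdempotentElem he hf :=
    have hef := isIdempotentElem_mul_of_inverse_unique hinv huniq he hf
    have hfe := isIdempotentElem_mul_of_inverse_unique hinv huniq hf he
    huniq (.of_isIdempotentElem hef) (.mul_comm_of_isIdempotentElem he hf hef hfe)

theorem of_regular_of_idempotent_unique (hreg : ∀ a : S, ∃ x, a * x * a = a)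
    (hL : ∀ {e f : S}, IsIdempotentElem e → IsIdempotentElem f →
      e * f = e → f * e = f → e = f)
    (hR : ∀ {e f : S}, IsIdempotentElem e → IsIdempotentElem f →
      e * f = f → f * e = e → e = f) : InverseSemigroup S := by
  refine of_inverse_unique (fun a => (hreg a).imp' _ fun _ => .of_mul_mul_cancel) ?_
  intro a x y hx hy
  have hax : a * x = a * y := hR hx.isIdempotentElem_mul hy.isIdempotentElem_mul
    (by rw [← mul_assoc, hx.1]) (by rw [← mul_assoc, hy.1])
  have hxa : x * a = y * a := hL hx.symm.isIdempotentElem_mul hy.symm.isIdempotentElem_mul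
    (by rw [mul_assoc, ← mul_assoc a, hy.1]) (by rw [mul_assoc, ← mul_assoc a, hx.1])
  calc x = x * a * x := hx.2.symm
    _ = y * a * y := by rw [mul_assoc, hax, ← mul_assoc, hxa]
    _ = y := hy.2

end Criterion

variable {S : Type*} [Semigroup S] [InverseSemigroup S]

/-- The inverse of an element of an inverse semigroup. -/
noncomputable def inverse (a : S) : S := (exists_mutuallyInverse a).choose

theorem mutuallyInverse_inverse (a : S) : MutuallyInverse a (inverse a) :=
  (exists_mutuallyInverse a).choose_spec

theorem eq_of_mul_eq_left {e f : S} (he : IsIdempotentElem e) (hf : IsIdempotentElem f)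
    (hef : e * f = e) (hfe : f * e = f) : e = f := by
  rw [← hef, mul_comm_of_isIdempotentElem he hf, hfe]

theorem inverse_mul_self_eq {a e x : S} (he : IsIdempotentElem e) (hae : a * e = a)
    (hxa : x * a = e) : inverse a * a = e := by
  refine eq_of_mul_eq_left (mutuallyInverse_inverse a).symm.isIdempotentElem_mul he ?_ ?_
  · rw [mul_assoc, hae]
  · rw [← hxa, mul_assoc, ← mul_assoc a, (mutuallyInverse_inverse a).mul_mul_cancel_left]

end InverseSemigroup

/-! ### The category of principal left ideals -/

/-- The principal left ideals `S e` generated by idempotents, each encoded by a generating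
idempotent. In an inverse semigroup every principal left ideal has exactly one such generator. -/
@[ext]
structure PrincipalLeftIdeal (S : Type u) [Semigroup S] where
  gen : S
  isIdempotentElem : IsIdempotentElem gen

namespace PrincipalLeftIdeal

section Semigroup

variable {S : Type u} [Semigroup S]

/-- The morphisms `S e ⟶ S f`: the right translations by the elements `val` of `e S f`. -/
@[ext]
structure Hom (e f : PrincipalLeftIdeal S) where
  val : S
  gen_mul : e.gen * val = val
  mul_gen : val * f.gen = val

instance : SmallCategory (PrincipalLeftIdeal S) where
  Hom := Hom
  id e := ⟨e.gen, e.isIdempotentElem, e.isIdempotentElem⟩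
  comp a b := ⟨a.val * b.val, by rw [← mul_assoc, a.gen_mul], by rw [mul_assoc, b.mul_gen]⟩
  id_comp a := Hom.ext a.gen_mul
  comp_id a := Hom.ext a.mul_gen
  assoc a b c := Hom.ext (mul_assoc a.val b.val c.val)

variable {e f g : PrincipalLeftIdeal S}

@[ext]
theorem hom_ext {a b : e ⟶ f} (h : a.val = b.val) : a = b := Hom.ext h

@[simp]
theorem id_val (e : PrincipalLeftIdeal S) : (𝟙 e : e ⟶ e).val = e.gen := rfl

@[simp]
theorem comp_val (a : e ⟶ f) (b : f ⟶ g) : (a ≫ b).val = a.val * b.val := rfl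

theorem comp_eqToHom_val (a : e ⟶ f) (h : f = g) : (a ≫ eqToHom h).val = a.val := by
  subst h
  simp

theorem eqToHom_comp_val (h : e = f) (a : f ⟶ g) : (eqToHom h ≫ a).val = a.val := by
  subst h
  simp

theorem functor_ext_iff {A : Type*} [Category* A] {F G : A ⥤ PrincipalLeftIdeal S} :
    F = G ↔ ∀ {a b : A} (m : a ⟶ b), (F.map m).val = (G.map m).val := by
  refine ⟨fun h => by subst h; simp, fun h => ?_⟩
  have hobj (a : A) : F.obj a = G.obj a :=
    PrincipalLeftIdeal.ext (by simpa only [F.map_id, G.map_id, id_val] using h (𝟙 a))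
  refine CategoryTheory.Functor.ext hobj fun a b m => hom_ext ?_
  rw [eqToHom_comp_val, comp_eqToHom_val, h]

/-- The right translation `S e ⟶ S f` by the product `e f`. -/
def translation (e f : PrincipalLeftIdeal S) : e ⟶ f where
  val := e.gen * f.gen
  gen_mul := e.isIdempotentElem.mul_self_mul f.gen
  mul_gen := f.isIdempotentElem.mul_mul_self e.gen

@[simp]
theorem translation_val (e f : PrincipalLeftIdeal S) :
    (translation e f).val = e.gen * f.gen := rfl

theorem translation_self (e : PrincipalLeftIdeal S) : translation e e = 𝟙 e :=
  hom_ext e.isIdempotentElem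

theorem comp_translation_comp_val {e' f' : PrincipalLeftIdeal S} (a : e ⟶ e') (b : f' ⟶ f) :
    (a ≫ translation e' f' ≫ b).val = a.val * b.val := by
  rw [comp_val, comp_val, translation_val, mul_assoc, b.gen_mul, ← mul_assoc, a.mul_gen]

theorem translation_comp_translation (h : e.gen * f.gen = e.gen) :
    translation e f ≫ translation f e = 𝟙 e :=
  hom_ext (by rw [comp_val, translation_val, translation_val, h, ← mul_assoc, h,
    e.isIdempotentElem, id_val])

/-- The functor between the categories of principal left ideals given by a homomorphism. -/
def map {T : Type u} [Semigroup T] (φ : S →ₙ* T) :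
    PrincipalLeftIdeal S ⥤ PrincipalLeftIdeal T where
  obj e := ⟨φ e.gen, e.isIdempotentElem.map φ⟩
  map a := ⟨φ a.val, by rw [← map_mul, a.gen_mul], by rw [← map_mul, a.mul_gen]⟩
  map_comp a b := hom_ext (map_mul φ a.val b.val)

theorem map_map_translation {T : Type u} [Semigroup T] (φ : S →ₙ* T)
    (e f : PrincipalLeftIdeal S) :
    (map φ).map (translation e f) = translation ((map φ).obj e) ((map φ).obj f) :=
  hom_ext (map_mul φ e.gen f.gen)

end Semigroup

section Normal

variable {S : Type u} [Semigroup S] [InverseSemigroup S] {e f : PrincipalLeftIdeal S}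

open InverseSemigroup

theorem gen_mul_gen_comm (e f : PrincipalLeftIdeal S) : e.gen * f.gen = f.gen * e.gen :=
  mul_comm_of_isIdempotentElem e.isIdempotentElem f.isIdempotentElem

theorem translation_comp_translation_iff :
    translation e f ≫ translation f e = 𝟙 e ↔ e.gen * f.gen = e.gen := by
  refine ⟨fun h => ?_, translation_comp_translation⟩
  calc e.gen * f.gen = e.gen * f.gen * (f.gen * e.gen) := by
        rw [← mul_assoc, f.isIdempotentElem.mul_mul_self, mul_assoc, gen_mul_gen_comm f,
          e.isIdempotentElem.mul_self_mul]
    _ = e.gen := congrArg Hom.val h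

theorem translation_comp_comp_translation_val {e' f' : PrincipalLeftIdeal S}
    (he : e'.gen * e.gen = e'.gen) (hf : f'.gen * f.gen = f'.gen) (a : e' ⟶ f') :
    (translation e e' ≫ a ≫ translation f' f).val = a.val := by
  rw [comp_val, comp_val, translation_val, translation_val, hf, a.mul_gen, gen_mul_gen_comm, he,
    a.gen_mul]

instance : CategoryWithSubobjects (PrincipalLeftIdeal S) where
  incl := fun {e _} a => a.val = e.gen
  id_incl _ := rfl
  comp_incl a b ha hb := by rw [comp_val, hb, a.mul_gen, ha]
  incl_unique a b ha hb := hom_ext (ha.trans hb.symm)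
  incl_strict {e f} a b ha hb _ _ := by
    obtain rfl : e = f := PrincipalLeftIdeal.ext
      (eq_of_mul_eq_left e.isIdempotentElem f.isIdempotentElem
        (by rw [← ha, a.mul_gen]) (by rw [← hb, b.mul_gen]))
    exact ⟨rfl, hom_ext ha⟩
  mono_of_incl a ha := ⟨fun b c h => hom_ext (by
    simpa only [comp_val, ha, Hom.mul_gen] using congrArg Hom.val h)⟩
  incl_of_comp a b hab hb := by rwa [comp_val, hb, a.mul_gen] at hab

theorem isInclusion_iff {j : e ⟶ f} : IsInclusion j ↔ j.val = e.gen := Iff.rfl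

theorem isInclusion_translation (h : e.gen * f.gen = e.gen) : IsInclusion (translation e f) := h

theorem subLE_iff : SubLE e f ↔ e.gen * f.gen = e.gen :=
  ⟨fun ⟨j, hj⟩ => by rw [← isInclusion_iff.1 hj, j.mul_gen],
    fun h => ⟨translation e f, isInclusion_translation h⟩⟩

theorem eq_translation_of_isInclusion {j : e ⟶ f} (hj : IsInclusion j) : j = translation e f :=
  CategoryWithSubobjects.incl_unique _ _ hj (isInclusion_translation (subLE_iff.1 ⟨j, hj⟩))

/-- The principal left ideal generated by `a`. -/
noncomputable def ran (a : S) : PrincipalLeftIdeal S :=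
  ⟨inverse a * a, (mutuallyInverse_inverse a).symm.isIdempotentElem_mul⟩

/-- The principal left ideal generated by the inverse of `a`. -/
noncomputable def dom (a : S) : PrincipalLeftIdeal S :=
  ⟨a * inverse a, (mutuallyInverse_inverse a).isIdempotentElem_mul⟩

theorem dom_gen_mul (a : S) : (dom a).gen * a = a := (mutuallyInverse_inverse a).1

theorem mul_ran_gen (a : S) : a * (ran a).gen = a :=
  (mul_assoc a _ a).symm.trans (mutuallyInverse_inverse a).1

theorem ran_eq {a x : S} (hae : a * e.gen = a) (hxa : x * a = e.gen) : ran a = e :=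
  PrincipalLeftIdeal.ext (inverse_mul_self_eq e.isIdempotentElem hae hxa)

theorem ran_gen (e : PrincipalLeftIdeal S) : ran e.gen = e :=
  ran_eq e.isIdempotentElem e.isIdempotentElem

/-- The isomorphism `S a a⁻¹ ≅ S a⁻¹ a` given by right translation by `a`. -/
noncomputable def isoOf (a : S) : dom a ≅ ran a where
  hom := ⟨a, dom_gen_mul a, mul_ran_gen a⟩
  inv := ⟨inverse a, (mutuallyInverse_inverse a).2,
    (mul_assoc (inverse a) a _).symm.trans (mutuallyInverse_inverse a).2⟩

theorem dom_val_gen_mul (a : e ⟶ f) : (dom a.val).gen * e.gen = (dom a.val).gen := by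
  rw [gen_mul_gen_comm, dom, ← mul_assoc, a.gen_mul]

theorem ran_val_gen_mul (a : e ⟶ f) : (ran a.val).gen * f.gen = (ran a.val).gen := by
  rw [ran, mul_assoc, a.mul_gen]

theorem normal_factorisation (a : e ⟶ f) :
    translation e (dom a.val) ≫ (isoOf a.val).hom ≫ translation (ran a.val) f = a :=
  hom_ext (translation_comp_comp_translation_val (dom_val_gen_mul a) (ran_val_gen_mul a) _)

/-- The idempotent cone with vertex `S e`, formed by the right translations by `e`. -/
def idempotentCone (e : PrincipalLeftIdeal S) : ConeAt e where
  app f := translation f e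
  incl_app {f g} j hj := hom_ext (by
    rw [comp_val, translation_val, ← mul_assoc, j.mul_gen, isInclusion_iff.1 hj, translation_val])
  exists_isIso := ⟨e, by rw [translation_self]; infer_instance⟩

instance : NormalCategory (PrincipalLeftIdeal S) where
  split {e f} j hj := ⟨translation f e, by
    rw [eq_translation_of_isInclusion hj, translation_comp_translation (subLE_iff.1 ⟨j, hj⟩)]⟩
  normal_factorisation {e f} a :=
    ⟨dom a.val, ran a.val, translation e (dom a.val), (isoOf a.val).hom,
      translation (ran a.val) f,
      ⟨translation (dom a.val) e, isInclusion_translation (dom_val_gen_mul a),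
        translation_comp_translation (dom_val_gen_mul a)⟩,
      inferInstance, isInclusion_translation (ran_val_gen_mul a), (normal_factorisation a).symm⟩
  exists_cone e := ⟨idempotentCone e, translation_self e⟩

theorem isIdem_idempotentCone (e : PrincipalLeftIdeal S) : (idempotentCone e).IsIdem :=
  Cones.mul_eq_left (idempotentCone e) (idempotentCone e) (translation_self e)

end Normal

/-! ### Principal cones -/

section PrincipalCones

variable {S : Type u} [Semigroup S] [InverseSemigroup S] {e f : PrincipalLeftIdeal S}

open InverseSemigroup

/-- The principal cone of `a`: its vertex is `S a`, and its components are the right translations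
`S f ⟶ S a` by `a`. -/
noncomputable abbrev principal (a : S) : Cones (PrincipalLeftIdeal S) :=
  ⟨ran a, (idempotentCone (dom a)).star (isoOf a).hom⟩

theorem principal_app_val (a : S) (f : PrincipalLeftIdeal S) :
    ((principal a).cone.app f).val = f.gen * a :=
  (mul_assoc f.gen _ a).trans (congrArg (f.gen * ·) (dom_gen_mul a))

theorem cones_ext {γ δ : Cones (PrincipalLeftIdeal S)} (hv : γ.vertex = δ.vertex)
    (h : ∀ f, (γ.cone.app f).val = (δ.cone.app f).val) : γ = δ :=
  Cones.ext_eqToHom hv fun f => hom_ext ((comp_eqToHom_val _ hv).trans (h f))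

theorem principal_gen (e : PrincipalLeftIdeal S) :
    principal e.gen = ⟨e, idempotentCone e⟩ :=
  cones_ext (ran_gen e) (principal_app_val e.gen)

theorem principal_injective :
    Function.Injective (principal : S → Cones (PrincipalLeftIdeal S)) := by
  intro a b h
  have hmul (f : PrincipalLeftIdeal S) : f.gen * a = f.gen * b := by
    rw [← principal_app_val, h, principal_app_val]
  calc a = (dom a).gen * b := by rw [← hmul, dom_gen_mul]
    _ = (dom b).gen * ((dom a).gen * b) := by
      rw [← mul_assoc, gen_mul_gen_comm, mul_assoc, dom_gen_mul]
    _ = b := by rw [← hmul (dom a), dom_gen_mul, hmul, dom_gen_mul]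

instance epi_translation_dom (a : e ⟶ f) : Epi (translation e (dom a.val)) :=
  (IsSplitEpi.mk' ⟨translation (dom a.val) e,
    translation_comp_translation (dom_val_gen_mul a)⟩).epi

theorem principal_mul (a : S) (χ : Cones (PrincipalLeftIdeal S)) :
    principal a * χ = principal (a * (χ.cone.app (ran a)).val) := by
  set b := χ.cone.app (ran a)
  have hran : ran (a * b.val) = ran b.val :=
    ran_eq (x := inverse b.val * inverse a) (by rw [mul_assoc, mul_ran_gen]) (by
      rw [mul_assoc, ← mul_assoc (inverse a)]
      exact congrArg (inverse b.val * ·) b.gen_mul)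
  rw [Cones.mul_eq_star (principal a) χ (translation (ran a) (dom b.val) ≫ (isoOf b.val).hom)
    (translation (ran b.val) χ.vertex) (isInclusion_translation (ran_val_gen_mul b))
    ((Category.assoc _ _ _).trans (normal_factorisation b))]
  refine cones_ext hran.symm fun f => ?_
  have hb : (ran a).gen * (dom b.val).gen * b.val = b.val := by
    rw [mul_assoc, dom_gen_mul, b.gen_mul]
  calc ((principal a).cone.app f).val * ((ran a).gen * (dom b.val).gen * b.val)
      = f.gen * (a * b.val) := by rw [hb, principal_app_val, mul_assoc]
    _ = ((principal (a * b.val)).cone.app f).val := (principal_app_val _ f).symm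

theorem principal_mul_principal (a b : S) : principal a * principal b = principal (a * b) := by
  rw [principal_mul, principal_app_val, ← mul_assoc, mul_ran_gen]

theorem principal_le_principal_iff {a b : S} : principal a ≤ principal b ↔ ∃ x, a = b * x := by
  constructor
  · rintro ⟨χ, hχ⟩
    exact ⟨_, principal_injective (hχ.trans (principal_mul b χ))⟩
  · rintro ⟨x, rfl⟩
    exact ⟨principal x, (principal_mul_principal b x).symm⟩

variable (S) in
/-- The down-set of the `R`-classes of the principal cones. -/
def principalClasses : LowerSet (RClasses (PrincipalLeftIdeal S)) where
  carrier := {d | ∃ a : S, rClass (principal a).cone = d}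
  lower' := by
    rintro _ d h ⟨a, rfl⟩
    induction d using Antisymmetrization.ind with
    | _ γ =>
      obtain ⟨χ, rfl⟩ : γ ≤ principal a := rClass_le_rClass.1 h
      exact ⟨_, congrArg (toAntisymmetrization (· ≤ ·)) (principal_mul a χ).symm⟩

theorem exists_principal_eq_of_rClass_mem {ε : ConeAt e} (h : rClass ε ∈ principalClasses S) :
    ∃ a : S, principal a = ⟨e, ε⟩ := by
  obtain ⟨a, ha⟩ := h
  obtain ⟨χ, hχ⟩ := rClass_le_rClass.1 ha.ge
  exact ⟨_, (principal_mul a χ).symm.trans hχ.symm⟩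

theorem rClass_idempotentCone_mem (e : PrincipalLeftIdeal S) :
    rClass (idempotentCone e) ∈ principalClasses S :=
  ⟨e.gen, congrArg (toAntisymmetrization (· ≤ ·)) (principal_gen e)⟩

theorem eq_idempotentCone {ε : ConeAt e} (hε : ε.IsIdem) (h : rClass ε ∈ principalClasses S) :
    ε = idempotentCone e := by
  obtain ⟨a, ha⟩ := exists_principal_eq_of_rClass_mem h
  have hidem : IsIdempotentElem a :=
    principal_injective (by rw [← principal_mul_principal, ha, hε.eq])
  obtain rfl : a = e.gen :=
    (congrArg gen (ran_gen ⟨a, hidem⟩)).symm.trans (congrArg (gen ∘ Cones.vertex) ha)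
  simpa [principal_gen] using ha.symm

variable (S) in
/-- The connected category of the principal left ideals of an inverse semigroup. -/
abbrev leftIdealCat : ConnectedCat.{u} where
  carrier := PrincipalLeftIdeal S
  down := principalClasses S
  connected e := ⟨⟨_, rClass_idempotentCone_mem e⟩, idempotentCone e, isIdem_idempotentCone e, rfl⟩

variable (S) in
theorem isSupported_leftIdealCat : IsSupported (leftIdealCat S) := by
  refine fun e => ⟨⟨_, rClass_idempotentCone_mem e⟩,
    ⟨idempotentCone e, isIdem_idempotentCone e, rfl⟩, ?_⟩
  rintro ⟨_, hd⟩ ⟨ε, hε, rfl⟩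
  exact Subtype.ext (congrArg rClass (eq_idempotentCone hε hd))

theorem suppCone_leftIdealCat (e : PrincipalLeftIdeal S) :
    (isSupported_leftIdealCat S).suppCone e = idempotentCone e :=
  ((isSupported_leftIdealCat S).eq_suppCone (isIdem_idempotentCone e)
    (rClass_idempotentCone_mem e)).symm

theorem supportMap_leftIdealCat (e : PrincipalLeftIdeal S) :
    (supportMap (isSupported_leftIdealCat S) e).1 = rClass (idempotentCone e) := by
  rw [← IsSupported.rClass_suppCone, suppCone_leftIdealCat]

theorem subLE_iff_supportMap_le (e f : PrincipalLeftIdeal S) :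
    SubLE e f ↔ supportMap (isSupported_leftIdealCat S) e ≤
      supportMap (isSupported_leftIdealCat S) f := by
  rw [← Subtype.coe_le_coe, supportMap_leftIdealCat, supportMap_leftIdealCat, rClass_le_rClass,
    ← principal_gen, ← principal_gen, principal_le_principal_iff, subLE_iff, gen_mul_gen_comm]
  constructor
  · exact fun h => ⟨e.gen, h.symm⟩
  · rintro ⟨x, hx⟩
    rw [hx, f.isIdempotentElem.mul_self_mul]

theorem supportMap_leftIdealCat_surjective :
    Function.Surjective (supportMap (isSupported_leftIdealCat S)) := by
  rintro ⟨_, a, rfl⟩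
  have hle : principal (dom a).gen ≤ principal a :=
    principal_le_principal_iff.2 ⟨inverse a, rfl⟩
  have hge : principal a ≤ principal (dom a).gen :=
    principal_le_principal_iff.2 ⟨a, (dom_gen_mul a).symm⟩
  rw [principal_gen] at hle hge
  exact ⟨dom a, Subtype.ext ((supportMap_leftIdealCat _).trans
    (le_antisymm (rClass_le_rClass.2 hle) (rClass_le_rClass.2 hge)))⟩

variable (S) in
theorem isSelfSupported_leftIdealCat : IsSelfSupported (leftIdealCat S) := by
  refine ⟨isSupported_leftIdealCat S, ⟨fun e f h => ?_, supportMap_leftIdealCat_surjective⟩,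
    subLE_iff_supportMap_le⟩
  exact SubLE.antisymm ((subLE_iff_supportMap_le e f).2 h.le)
    ((subLE_iff_supportMap_le f e).2 h.ge)

end PrincipalCones

/-! ### The functor from inverse semigroups to self-supported categories -/

section Functor

variable {S T : Type u} [Semigroup S] [Semigroup T]

theorem map_injective [InverseSemigroup S] : Function.Injective
    (map : (S →ₙ* T) → PrincipalLeftIdeal S ⥤ PrincipalLeftIdeal T) :=
  fun _ _ h => MulHom.ext fun a => functor_ext_iff.1 h (isoOf a).hom

variable [InverseSemigroup T] (F : PrincipalLeftIdeal S ⥤ PrincipalLeftIdeal T)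
  (hF : ∀ e f, F.map (translation e f) = translation (F.obj e) (F.obj f))

include hF

theorem obj_gen_mul_obj_gen {e f : PrincipalLeftIdeal S} (h : e.gen * f.gen = e.gen) :
    (F.obj e).gen * (F.obj f).gen = (F.obj e).gen := by
  rw [← translation_comp_translation_iff, ← hF, ← hF, ← F.map_comp,
    translation_comp_translation h, F.map_id]

variable [InverseSemigroup S]

theorem map_val_eq {e f : PrincipalLeftIdeal S} (a : e ⟶ f) :
    (F.map a).val = (F.map (isoOf a.val).hom).val := by
  conv_lhs => rw [← normal_factorisation a, F.map_comp, F.map_comp, hF, hF]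
  exact translation_comp_comp_translation_val (obj_gen_mul_obj_gen F hF (dom_val_gen_mul a))
    (obj_gen_mul_obj_gen F hF (ran_val_gen_mul a)) _

/-- The homomorphism of inverse semigroups given by a functor that preserves the translations by
products of idempotents. -/
noncomputable def toMulHom : S →ₙ* T where
  toFun a := (F.map (isoOf a).hom).val
  map_mul' a b := by
    let c : dom a ⟶ ran b := (isoOf a).hom ≫ translation (ran a) (dom b) ≫ (isoOf b).hom
    have hc : c.val = a * b := comp_translation_comp_val _ _
    calc (F.map (isoOf (a * b)).hom).val = (F.map c).val := by rw [map_val_eq F hF c, hc]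
      _ = (F.map (isoOf a).hom).val * (F.map (isoOf b).hom).val := by
        rw [F.map_comp, F.map_comp, hF, comp_translation_comp_val]

theorem map_toMulHom : map (toMulHom F hF) = F :=
  functor_ext_iff.2 fun a => (map_val_eq F hF a).symm

end Functor

end PrincipalLeftIdeal

open PrincipalLeftIdeal

section CCHom

variable {S T : Type u} [Semigroup S] [Semigroup T] [InverseSemigroup S] [InverseSemigroup T]

/-- The morphism of connected categories given by a homomorphism of inverse semigroups. -/
noncomputable def leftIdealCCHom (φ : S →ₙ* T) : CCHom (leftIdealCat S) (leftIdealCat T) :=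
  CCHom.ofFunctor (isSelfSupported_leftIdealCat S) (isSelfSupported_leftIdealCat T) (map φ)
    (fun _ hj => congrArg φ hj)
    (fun e f => by
      rw [suppCone_leftIdealCat, suppCone_leftIdealCat]
      exact map_map_translation φ f e)

theorem CCHom.map_translation (m : CCHom (leftIdealCat S) (leftIdealCat T))
    (e f : PrincipalLeftIdeal S) :
    m.functor.map (translation e f) = translation (m.functor.obj e) (m.functor.obj f) := by
  have h := m.map_suppCone (isSupported_leftIdealCat S) (isSupported_leftIdealCat T) f e
  rwa [suppCone_leftIdealCat, suppCone_leftIdealCat] at h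

theorem leftIdealCCHom_injective : Function.Injective
    (leftIdealCCHom : (S →ₙ* T) → CCHom (leftIdealCat S) (leftIdealCat T)) :=
  fun _ _ h => map_injective (congrArg CCHom.functor h)

theorem leftIdealCCHom_surjective : Function.Surjective
    (leftIdealCCHom : (S →ₙ* T) → CCHom (leftIdealCat S) (leftIdealCat T)) :=
  fun m => ⟨toMulHom m.functor m.map_translation,
    CCHom.ext_functor (isSelfSupported_leftIdealCat S) (isSupported_leftIdealCat T)
      (map_toMulHom m.functor m.map_translation)⟩

end CCHom

instance (S : InverseSemigrp.{u}) : InverseSemigroup S.obj where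
  exists_mutuallyInverse a := (S.property.1 a).imp fun _ h => ⟨h.1, h.2⟩
  mul_comm_of_isIdempotentElem := S.property.2 _ _

/-- The functor from inverse semigroups to self-supported categories. -/
noncomputable def leftIdealFunctor : InverseSemigrp.{u} ⥤ SelfSupportedCat.{u} where
  obj S := ⟨leftIdealCat S.obj, isSelfSupported_leftIdealCat S.obj⟩
  map φ := ObjectProperty.homMk (leftIdealCCHom φ.hom.hom)
  map_id S := ObjectProperty.hom_ext _ (CCHom.ext_functor
    (isSelfSupported_leftIdealCat S.obj) (isSupported_leftIdealCat S.obj) rfl)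
  map_comp {S _ T} _ _ := ObjectProperty.hom_ext _ (CCHom.ext_functor
    (isSelfSupported_leftIdealCat S.obj) (isSupported_leftIdealCat T.obj) rfl)

instance : leftIdealFunctor.{u}.Faithful where
  map_injective h := ObjectProperty.hom_ext _ (Semigrp.hom_ext
    (leftIdealCCHom_injective (congrArg (fun m => m.hom) h)))

instance : leftIdealFunctor.{u}.Full where
  map_surjective m := by
    obtain ⟨φ, hφ⟩ := leftIdealCCHom_surjective m.hom
    exact ⟨ObjectProperty.homMk (Semigrp.ofHom φ), ObjectProperty.hom_ext _ hφ⟩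

/-! ### Semigroups of cones -/

section ConeSubsemigroup

variable {C : Type u} [Category.{v} C] [NormalCategory C]

/-- The semigroup of the cones whose `R`-classes lie in a down-set. -/
def coneSubsemigroup (D : LowerSet (RClasses C)) : Subsemigroup (Cones C) where
  carrier := {γ | rClass γ.cone ∈ D}
  mul_mem' {γ δ} hγ _ := D.lower (rClass_le_rClass.2 (Cones.mul_le_left γ δ)) hγ

namespace coneSubsemigroup

variable {D : LowerSet (RClasses C)}

theorem mem_of_le {γ δ : Cones C} (h : γ ≤ δ) (hδ : δ ∈ coneSubsemigroup D) :
    γ ∈ coneSubsemigroup D := D.lower (rClass_le_rClass.2 h) hδ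

section Idempotents

variable {e f : coneSubsemigroup D}

theorem isIdem_cone (he : IsIdempotentElem e) : e.1.cone.IsIdem := congrArg Subtype.val he

theorem mul_eq_left_iff (hf : IsIdempotentElem f) :
    e * f = e ↔ SubLE e.1.vertex f.1.vertex := by
  refine ⟨fun h => ?_, fun h =>
    Subtype.ext (Cones.mul_eq_left_of_subLE (isIdem_cone hf).app_vertex h)⟩
  rw [← h]
  exact Cones.subLE_vertex_mul e.1 f.1

end Idempotents

variable {e f g : PrincipalLeftIdeal (coneSubsemigroup D)}

/-- The vertex of the idempotent cone that generates a principal left ideal. -/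
abbrev vertex (e : PrincipalLeftIdeal (coneSubsemigroup D)) : C := e.gen.1.vertex

theorem app_vertex (e : PrincipalLeftIdeal (coneSubsemigroup D)) :
    e.gen.1.cone.app (vertex e) = 𝟙 (vertex e) :=
  (isIdem_cone e.isIdempotentElem).app_vertex

theorem subLE_vertex (a : e ⟶ f) : SubLE a.val.1.vertex (vertex f) :=
  (mul_eq_left_iff f.isIdempotentElem).1 a.mul_gen

/-- The morphism of vertices given by a right translation by a cone: the component of the cone at
the vertex of the domain, regarded as a morphism to the vertex of the codomain. -/
noncomputable def vertexMap (a : e ⟶ f) : vertex e ⟶ vertex f :=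
  a.val.1.cone.app (vertex e) ≫ (subLE_vertex a).incl

theorem vertexMap_eq (a : e ⟶ f) {j : a.val.1.vertex ⟶ vertex f} (hj : IsInclusion j) :
    vertexMap a = a.val.1.cone.app (vertex e) ≫ j := by
  rw [vertexMap, (subLE_vertex a).eq_incl hj]

theorem isInclusion_vertexMap {a : e ⟶ f} (h : a.val = e.gen) : IsInclusion (vertexMap a) := by
  obtain ⟨γ, hγ, hγf⟩ := a
  obtain rfl : γ = e.gen := h
  rw [vertexMap, app_vertex, Category.id_comp]
  exact SubLE.isInclusion_incl _

theorem vertexMap_comp (a : e ⟶ f) (b : f ⟶ g) :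
    vertexMap (a ≫ b) = vertexMap a ≫ vertexMap b := by
  let x := b.val.1.cone.app a.val.1.vertex
  have hj : IsInclusion (inclPart x ≫ (subLE_vertex b).incl) :=
    CategoryWithSubobjects.comp_incl _ _ (inclPart_incl x) (SubLE.isInclusion_incl _)
  have hx : (subLE_vertex a).incl ≫ b.val.1.cone.app (vertex f) = x :=
    b.val.1.cone.incl_app _ (SubLE.isInclusion_incl _)
  calc vertexMap (a ≫ b)
      = (a.val.1.cone.app (vertex e) ≫ epiPart x) ≫ inclPart x ≫ (subLE_vertex b).incl :=
        vertexMap_eq (a ≫ b) hj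
    _ = a.val.1.cone.app (vertex e) ≫ x ≫ (subLE_vertex b).incl := by
        rw [Category.assoc, ← Category.assoc (epiPart x), epiPart_inclPart]
    _ = vertexMap a ≫ vertexMap b := by
        rw [← hx, vertexMap, vertexMap]
        simp only [Category.assoc]

variable (D) in
/-- The functor that sends a principal left ideal to the vertex of the idempotent cone that
generates it. -/
noncomputable def vertexFunctor : PrincipalLeftIdeal (coneSubsemigroup D) ⥤ C where
  obj := vertex
  map := vertexMap
  map_id e := CategoryWithSubobjects.incl_unique _ _ (isInclusion_vertexMap (id_val e))
    (CategoryWithSubobjects.id_incl _)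
  map_comp := vertexMap_comp

theorem epi_app_vertex (a : e ⟶ f) : Epi (a.val.1.cone.app (vertex e)) :=
  Cones.epi_app_vertex_of_mul_eq (app_vertex e) (congrArg Subtype.val a.gen_mul)

theorem app_eq_app_comp_app_vertex (a : e ⟶ f) (c : C) :
    a.val.1.cone.app c = e.gen.1.cone.app c ≫ a.val.1.cone.app (vertex e) :=
  Cones.app_eq_app_comp_app_vertex_of_mul_eq (app_vertex e) (congrArg Subtype.val a.gen_mul) c

instance : (vertexFunctor D).Faithful where
  map_injective {e f a b} h := by
    have ha := epi_app_vertex a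
    have hb := epi_app_vertex b
    obtain ⟨hv, happ⟩ := canonical_unique _ _ _ _ (subLE_vertex a).isInclusion_incl
      (subLE_vertex b).isInclusion_incl h
    refine hom_ext (Subtype.ext (Cones.ext_eqToHom hv fun c => ?_))
    rw [app_eq_app_comp_app_vertex a, app_eq_app_comp_app_vertex b, Category.assoc, happ]

instance : (vertexFunctor D).Full where
  map_surjective {e f} g := by
    change vertex e ⟶ vertex f at g
    let γ : Cones C := ⟨im g, e.gen.1.cone.star (epiPart g)⟩
    have hγ : e.gen.1 * γ = γ := Cones.mul_star (app_vertex e) (epiPart g)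
    let γ' : coneSubsemigroup D := ⟨γ, mem_of_le ⟨γ, hγ.symm⟩ e.gen.2⟩
    have hf : γ' * f.gen = γ' :=
      (mul_eq_left_iff f.isIdempotentElem).2 ⟨inclPart g, inclPart_incl g⟩
    refine ⟨⟨γ', Subtype.ext hγ, hf⟩, (vertexMap_eq _ (inclPart_incl g)).trans ?_⟩
    change (e.gen.1.cone.app (vertex e) ≫ epiPart g) ≫ inclPart g = g
    rw [app_vertex, Category.id_comp, epiPart_inclPart]

theorem vertexFunctor_map_translation (e f : PrincipalLeftIdeal (coneSubsemigroup D)) :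
    (vertexFunctor D).map (translation f e) = e.gen.1.cone.app (vertex f) := by
  refine (vertexMap_eq _ (inclPart_incl (e.gen.1.cone.app (vertex f)))).trans ?_
  change (f.gen.1.cone.app (vertex f) ≫ epiPart (e.gen.1.cone.app (vertex f))) ≫
    inclPart (e.gen.1.cone.app (vertex f)) = _
  rw [app_vertex, Category.id_comp, epiPart_inclPart]

theorem isInclusion_vertexFunctor_map_iff [InverseSemigroup (coneSubsemigroup D)] (a : e ⟶ f) :
    IsInclusion ((vertexFunctor D).map a) ↔ IsInclusion a := by
  refine ⟨fun h => ?_, fun h => isInclusion_vertexMap h⟩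
  have hj : IsInclusion (translation e f) :=
    isInclusion_translation ((mul_eq_left_iff f.isIdempotentElem).2 ⟨_, h⟩)
  rwa [(vertexFunctor D).map_injective
    (CategoryWithSubobjects.incl_unique _ _ h (isInclusion_vertexMap hj))]

end coneSubsemigroup

end ConeSubsemigroup

/-! ### The semigroup of a self-supported category -/

section SelfSupported

variable {X : ConnectedCat.{u}}

open coneSubsemigroup

namespace IsSupported

variable {e f : coneSubsemigroup X.down}

/-- The idempotent cone of the support of `c`, as an element of the semigroup of the down-set. -/
noncomputable def suppElem (hX : IsSupported X) (c : X.carrier) : coneSubsemigroup X.down :=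
  ⟨⟨c, hX.suppCone c⟩, hX.rClass_suppCone_mem c⟩

theorem isIdempotentElem_suppElem (hX : IsSupported X) (c : X.carrier) :
    IsIdempotentElem (hX.suppElem c) := Subtype.ext (hX.isIdem_suppCone c)

theorem eq_suppElem (hX : IsSupported X) (he : IsIdempotentElem e) :
    e = hX.suppElem e.1.vertex :=
  Subtype.ext (congrArg (Cones.mk e.1.vertex) (hX.eq_suppCone (isIdem_cone he) e.2))

theorem eq_of_vertex_eq (hX : IsSupported X) (he : IsIdempotentElem e)
    (hf : IsIdempotentElem f) (h : e.1.vertex = f.1.vertex) : e = f := by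
  rw [hX.eq_suppElem he, hX.eq_suppElem hf, h]

theorem eq_of_mul_eq_left (hX : IsSupported X) (he : IsIdempotentElem e)
    (hf : IsIdempotentElem f) (hef : e * f = e) (hfe : f * e = f) : e = f :=
  hX.eq_of_vertex_eq he hf
    (SubLE.antisymm ((mul_eq_left_iff hf).1 hef) ((mul_eq_left_iff he).1 hfe))

theorem bijective_vertexFunctor_obj (hX : IsSupported X) :
    Function.Bijective (vertexFunctor X.down).obj :=
  ⟨fun e f h => PrincipalLeftIdeal.ext
      (hX.eq_of_vertex_eq e.isIdempotentElem f.isIdempotentElem h),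
    fun c => ⟨⟨hX.suppElem c, hX.isIdempotentElem_suppElem c⟩, rfl⟩⟩

theorem vertexFunctor_map_suppCone [InverseSemigroup (coneSubsemigroup X.down)]
    (hX : IsSupported X) (e f : PrincipalLeftIdeal (coneSubsemigroup X.down)) :
    (vertexFunctor X.down).map (((isSupported_leftIdealCat _).suppCone e).app f) =
      (hX.suppCone (vertex e)).app (vertex f) := by
  rw [suppCone_leftIdealCat, ← hX.eq_suppCone (isIdem_cone e.isIdempotentElem) e.gen.2]
  exact vertexFunctor_map_translation e f

end IsSupported

namespace IsSelfSupported

theorem eq_of_mul_eq_right (hX : IsSelfSupported X) {e f : coneSubsemigroup X.down}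
    (he : IsIdempotentElem e) (hf : IsIdempotentElem f) (hef : e * f = f) (hfe : f * e = e) :
    e = f := by
  have hs := hX.supported
  have hle : rClass e.1.cone ≤ rClass f.1.cone :=
    rClass_le_rClass.2 ⟨e.1, congrArg Subtype.val hfe.symm⟩
  have hge : rClass f.1.cone ≤ rClass e.1.cone :=
    rClass_le_rClass.2 ⟨f.1, congrArg Subtype.val hef.symm⟩
  rw [hs.eq_suppCone (isIdem_cone he) e.2, hs.eq_suppCone (isIdem_cone hf) f.2,
    hs.rClass_suppCone, hs.rClass_suppCone] at hle hge
  exact hs.eq_of_vertex_eq he hf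
    (SubLE.antisymm (hX.subLE_iff.2 hle) (hX.subLE_iff.2 hge))

theorem exists_mul_mul_eq_self (hX : IsSelfSupported X) (a : coneSubsemigroup X.down) :
    ∃ x, a * x * a = a := by
  have hs := hX.supported
  let c := hX.objOfSupport ⟨_, a.2⟩
  have hc : rClass (hs.suppCone c) = rClass a.1.cone := by
    rw [hs.rClass_suppCone, hX.supportMap_objOfSupport]
  obtain ⟨χ, hχ⟩ := rClass_le_rClass.1 hc.le
  have hca : (⟨c, hs.suppCone c⟩ : Cones X.carrier) * a.1 = a.1 :=
    Cones.mul_eq_right_of_le (hs.isIdem_suppCone c) (rClass_le_rClass.1 hc.ge)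
  let ε := hs.suppElem a.1.vertex
  have haε : a.1 * ε.1 = a.1 :=
    Cones.mul_eq_left a.1.cone _ (hs.isIdem_suppCone a.1.vertex).app_vertex
  refine ⟨⟨ε.1 * χ, mem_of_le (Cones.mul_le_left _ _) ε.2⟩, Subtype.ext ?_⟩
  calc a.1 * (ε.1 * χ) * a.1 = a.1 * χ * a.1 := by rw [← mul_assoc, haε]
    _ = a.1 := by rw [← hχ, hca]

theorem inverseSemigroup (hX : IsSelfSupported X) : InverseSemigroup (coneSubsemigroup X.down) :=
  .of_regular_of_idempotent_unique hX.exists_mul_mul_eq_self hX.supported.eq_of_mul_eq_left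
    hX.eq_of_mul_eq_right

/-- The isomorphism of a self-supported category with the category of principal left ideals of its
semigroup of cones. -/
noncomputable def leftIdealCatIso [InverseSemigroup (coneSubsemigroup X.down)]
    (hX : IsSelfSupported X) : leftIdealCat (coneSubsemigroup X.down) ≅ X :=
  isoOfFunctor (isSelfSupported_leftIdealCat _) hX (vertexFunctor X.down)
    hX.supported.bijective_vertexFunctor_obj isInclusion_vertexFunctor_map_iff
    hX.supported.vertexFunctor_map_suppCone

end IsSelfSupported

end SelfSupported

instance : leftIdealFunctor.{u}.EssSurj where
  mem_essImage X := by
    have hS := X.property.inverseSemigroup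
    let S : InverseSemigrp.{u} :=
      ⟨Semigrp.of (coneSubsemigroup X.obj.down),
        fun a => (hS.exists_mutuallyInverse a).imp fun _ h => ⟨h.1, h.2⟩,
        fun _ _ => hS.mul_comm_of_isIdempotentElem⟩
    exact ⟨S, ⟨ObjectProperty.isoMk _ X.property.leftIdealCatIso⟩⟩

instance : leftIdealFunctor.{u}.IsEquivalence where

end ConeSemigroups

theorem theorem6 :
    Nonempty (ConeSemigroups.InverseSemigrp.{u} ≌ ConeSemigroups.SelfSupportedCat.{u}) :=
  ⟨ConeSemigroups.leftIdealFunctor.asEquivalence⟩
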